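/- Let $\mathcal{R}$ be a left-linear term rewrite system (TRS), i.e. a possibly infinite set of rules $l \to r$ between first-order terms over some signature and an infinite set of variables, such that no $l$ is a variable, every variable of $r$ occurs in $l$, and no variable occurs more than once in a left-hand side $l$. Let $\mathcal{R}_{\mathsf{d}}$ be the subset of duplicating rules of $\mathcal{R}$ (rules $l \to r$ such that some variable occurs more often in $r$ than in $l$) and let $\mathcal{R}_{\mathsf{nd}} = \mathcal{R} \setminus \mathcal{R}_{\mathsf{d}}$. An overlap $(l_1 \to r_1, p, l_2 \to r_2)_\mu$ of $\mathcal{R}$ consists of variants $l_1 \to r_1$ and $l_2 \to r_2$ of rules of $\mathcal{R}$ without common variables, a position $p$ of a function symbol in $l_2$, and a most general unifier $\mu$ of $l_1$ and $l_2|_p$, where $l_1 \to r_1$ and $l_2 \to r_2$ are required not to be variants of each other if $p$ is the root position. It induces the critical pair $l_2\mu[r_1\mu]_p \approx r_2\mu$. Let $$\mathsf{CPS}(\mathcal{R}) = \{\, l_2\mu \to l_2\mu[r_1\mu]_p,\ l_2\mu \to r_2\mu \mid (l_1 \to r_1, p, l_2 \to r_2)_\mu \text{ is an overlap of } \mathcal{R}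 \,\}.$$ Suppose that 1. every critical pair $s \approx t$ of $\mathcal{R}$ is joinable, i.e. $s \to_{\mathcal{R}}^* u$ and $t \to_{\mathcal{R}}^* u$ for some term $u$; and 2. $\mathsf{CPS}(\mathcal{R}) \cup \mathcal{R}_{\mathsf{d}}$ is relatively terminating with respect to $\mathcal{R}_{\mathsf{nd}}$, i.e. there is no infinite sequence of steps of the relation $\to_{\mathcal{R}_{\mathsf{nd}}}^* \cdot \to_{\mathsf{CPS}(\mathcal{R}) \cup \mathcal{R}_{\mathsf{d}}} \cdot \to_{\mathcal{R}_{\mathsf{nd}}}^*$. Then $\mathcal{R}$ is confluent: whenever $s \to_{\mathcal{R}}^* t_1$ and $s \to_{\mathcal{R}}^* t_2$, there is a term $u$ with $t_1 \to_{\mathcal{R}}^* u$ and $t_2 \to_{\mathcal{R}}^* u$. -/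

import Mathlib

/-!
First-order term rewriting. Terms over a signature are Mathlib's first-order terms `L.Term V`
(the relation symbols of `L` play no role), and `t.subst σ` is the application of the
substitution `σ : V → L.Term V` to `t`.
-/

universe u v w

namespace Rewriting


/-- The number of occurrences of the variable `x` in a term. -/
noncomputable def count {L : FirstOrder.Language.{u, v}} {V : Type w} (x : V) : L.Term V → ℕ
  | .var y => open Classical in if x = y then 1 else 0
  | .func _ ts => ∑ i, count x (ts i)

/-- The set of variables occurring in a term. -/
def vars {L : FirstOrder.Language.{u, v}} {V : Type w} (t : L.Term V) : Set V :=
  {x | 0 < count x t}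

/-- A term is linear if no variable occurs in it more than once. -/
def Linear {L : FirstOrder.Language.{u, v}} {V : Type w} (t : L.Term V) : Prop :=
  ∀ x, count x t ≤ 1

/-- The subterm `t|_p` of `t` at position `p`; it is `none` if `p` is not a position of `t`.
Positions are lists of argument indices (starting at `0`), the root position being `[]`. -/
def subtermAt {L : FirstOrder.Language.{u, v}} {V : Type w} :
    L.Term V → List ℕ → Option (L.Term V)
  | t, [] => some t
  | .var _, _ :: _ => none
  | .func (l := n) _ ts, i :: p => if h : i < n then subtermAt (ts ⟨i, h⟩) p else none

/-- The term `t[s]_p`, in which the subterm of `t` at position `p` is replaced by `s`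
(only used for positions `p` of `t`). -/
def replaceAt {L : FirstOrder.Language.{u, v}} {V : Type w} :
    L.Term V → List ℕ → L.Term V → L.Term V
  | _, [], s => s
  | .var x, _ :: _, _ => .var x
  | .func f ts, i :: p, s =>
      .func f (fun j => if (j : ℕ) = i then replaceAt (ts j) p s else ts j)

/-- A pair of terms `lhs → rhs`. -/
structure Rule (L : FirstOrder.Language.{u, v}) (V : Type w) where
  lhs : L.Term V
  rhs : L.Term V

/-- The variables of a rule. -/
def Rule.vars {L : FirstOrder.Language.{u, v}} {V : Type w} (ρ : Rule L V) : Set V :=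
  Rewriting.vars ρ.lhs ∪ Rewriting.vars ρ.rhs

/-- A rule is duplicating if some variable occurs more often in its right-hand side than in its
left-hand side. -/
def Rule.Duplicating {L : FirstOrder.Language.{u, v}} {V : Type w} (ρ : Rule L V) : Prop :=
  ∃ x, count x ρ.lhs < count x ρ.rhs

/-- `ρ'` is a variant of `ρ` if it is obtained from `ρ` by a renaming, that is, by a bijective
replacement of variables by variables. -/
def Rule.IsVariant {L : FirstOrder.Language.{u, v}} {V : Type w} (ρ' ρ : Rule L V) : Prop :=
  ∃ π : Equiv.Perm V, ρ'.lhs = ρ.lhs.subst (fun x => .var (π x)) ∧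
    ρ'.rhs = ρ.rhs.subst (fun x => .var (π x))

/-- A set of rules is a term rewrite system if left-hand sides are not variables and all
variables of a right-hand side occur in the corresponding left-hand side. -/
structure IsTRS {L : FirstOrder.Language.{u, v}} {V : Type w} (R : Set (Rule L V)) : Prop where
  lhs_ne_var : ∀ ρ ∈ R, ∀ x, ρ.lhs ≠ .var x
  vars_rhs : ∀ ρ ∈ R, vars ρ.rhs ⊆ vars ρ.lhs

/-- All left-hand sides are linear. -/
def LeftLinear {L : FirstOrder.Language.{u, v}} {V : Type w} (R : Set (Rule L V)) : Prop :=
  ∀ ρ ∈ R, Linear ρ.lhs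

/-- The subset of duplicating rules. -/
def dupl {L : FirstOrder.Language.{u, v}} {V : Type w} (R : Set (Rule L V)) : Set (Rule L V) :=
  {ρ ∈ R | ρ.Duplicating}

/-- The subset of non-duplicating rules. -/
def nonDupl {L : FirstOrder.Language.{u, v}} {V : Type w} (R : Set (Rule L V)) :
    Set (Rule L V) :=
  {ρ ∈ R | ¬ ρ.Duplicating}

/-- The one-step rewrite relation `s →_R t`. -/
def Step {L : FirstOrder.Language.{u, v}} {V : Type w} (R : Set (Rule L V))
    (s t : L.Term V) : Prop :=
  ∃ ρ ∈ R, ∃ (p : List ℕ) (σ : V → L.Term V),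
    subtermAt s p = some (ρ.lhs.subst σ) ∧ t = replaceAt s p (ρ.rhs.subst σ)

/-- The relation `s →_R^* t`. -/
def Steps {L : FirstOrder.Language.{u, v}} {V : Type w} (R : Set (Rule L V)) :
    L.Term V → L.Term V → Prop :=
  Relation.ReflTransGen (Step R)

/-- The terms `s` and `t` have a common reduct. -/
def Joinable {L : FirstOrder.Language.{u, v}} {V : Type w} (R : Set (Rule L V))
    (s t : L.Term V) : Prop :=
  ∃ u, Steps R s u ∧ Steps R t u

/-- Any two reducts of a term have a common reduct. -/
def Confluent {L : FirstOrder.Language.{u, v}} {V : Type w} (R : Set (Rule L V)) : Prop :=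
  ∀ s t₁ t₂ : L.Term V, Steps R s t₁ → Steps R s t₂ → Joinable R t₁ t₂

/-- The relation `→_S^* · →_R · →_S^*`. -/
def RelStep {L : FirstOrder.Language.{u, v}} {V : Type w} (R S : Set (Rule L V))
    (s t : L.Term V) : Prop :=
  ∃ s' t', Steps S s s' ∧ Step R s' t' ∧ Steps S t' t

/-- `R` is relatively terminating with respect to `S`: there is no infinite sequence
`t₀, t₁, t₂, …` of consecutive `RelStep R S` steps. The relation is reversed here because
`WellFounded r` excludes infinite sequences with `r (t (n+1)) (t n)`. -/
def RelTerminating {L : FirstOrder.Language.{u, v}} {V : Type w} (R S : Set (Rule L V)) : Prop :=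
  WellFounded (fun t s : L.Term V => RelStep R S s t)

/-- `μ` is a most general unifier of `s` and `t`. -/
def IsMGU {L : FirstOrder.Language.{u, v}} {V : Type w} (μ : V → L.Term V)
    (s t : L.Term V) : Prop :=
  s.subst μ = t.subst μ ∧
    ∀ τ : V → L.Term V, s.subst τ = t.subst τ →
      ∃ δ : V → L.Term V, ∀ x, τ x = (μ x).subst δ

/-- `(ρ₁, p, ρ₂)_μ` is an overlap of `R`: `ρ₁` and `ρ₂` are variants of rules of `R` without common
variables, `p` is a position of a function symbol in the left-hand side of `ρ₂`, the substitution
`μ` is a most general unifier of the left-hand side of `ρ₁` and of the subterm at `p`, and if `p`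
is the root position then `ρ₁` and `ρ₂` are not variants. -/
structure IsOverlap {L : FirstOrder.Language.{u, v}} {V : Type w} (R : Set (Rule L V))
    (ρ₁ : Rule L V) (p : List ℕ) (ρ₂ : Rule L V) (μ : V → L.Term V) : Prop where
  variant_left : ∃ ρ ∈ R, ρ₁.IsVariant ρ
  variant_right : ∃ ρ ∈ R, ρ₂.IsVariant ρ
  disjoint_vars : Disjoint ρ₁.vars ρ₂.vars
  unify : ∃ t, subtermAt ρ₂.lhs p = some t ∧ (∀ x, t ≠ .var x) ∧ IsMGU μ ρ₁.lhs t
  not_variant : p = [] → ¬ ρ₁.IsVariant ρ₂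

/-- `s ≈ t` is a critical pair of `R`. -/
def CriticalPair {L : FirstOrder.Language.{u, v}} {V : Type w} (R : Set (Rule L V))
    (s t : L.Term V) : Prop :=
  ∃ ρ₁ p ρ₂ μ, IsOverlap R ρ₁ p ρ₂ μ ∧
    s = replaceAt (ρ₂.lhs.subst μ) p (ρ₁.rhs.subst μ) ∧ t = ρ₂.rhs.subst μ

/-- The critical pair steps of `R`: for each overlap, the two rewrite steps from its peak to the
two sides of the critical pair, viewed as rewrite rules. -/
def CPS {L : FirstOrder.Language.{u, v}} {V : Type w} (R : Set (Rule L V)) : Set (Rule L V) :=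
  {ρ | ∃ ρ₁ p ρ₂ μ, IsOverlap R ρ₁ p ρ₂ μ ∧
    (ρ = ⟨ρ₂.lhs.subst μ, replaceAt (ρ₂.lhs.subst μ) p (ρ₁.rhs.subst μ)⟩ ∨
      ρ = ⟨ρ₂.lhs.subst μ, ρ₂.rhs.subst μ⟩)}

end Rewriting

/-!
Confluence of left-linear term rewrite systems whose critical pair steps and duplicating rules
terminate relative to the non-duplicating rules.

Write `s > t` for the well-founded relation `RelStep (CPS R ∪ dupl R) (nonDupl R) s t`. The proof
is a well-founded induction along `>`, based on the following property of a local peak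
`t ← s → y` (`PeakJoin`): the peak is joinable, and either `s > y`, or the peak can be joined by
arbitrarily many steps from `t` and *at most one* step from `y`. It holds for all local peaks
(`peakJoin_of_step`):

* in a critical overlap both steps are instances of critical pair steps, so `s > y`, and
  joinability is inherited from the critical pair;
* if one redex lies below a variable `x` of the left-hand side `l` of the other, left-linearity
  gives the usual joining sequences, with one copy of the inner step for each occurrence of `x` in
  the right-hand side `r`. If the rule `l → r` is duplicating, contracting the outer redex yields a
  smaller term; otherwise there is at most one copy, since `x` occurs only once in `l`;
* steps at parallel positions commute.

Now let all terms smaller than `s` be confluent (`confluent_of_peakJoin`). For a step from a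
term `x` that is reachable from `s` by non-duplicating steps, either the result is smaller
than `s`, hence confluent, or it is again reachable from `s` by non-duplicating steps. So the strip
lemma, joining `t ← x → y →* t'` for such `x`, follows by induction on the length of
`x → y →* t'`: if `y` is smaller than `s`, its confluence and the joinability of the peak suffice,
and otherwise the single step from `y` allows the induction to proceed.

The definition of critical pairs refers to most general unifiers and to variants of rules without
common variables; `exists_isMGU` provides the former and `exists_overlap` reduces arbitrary
overlapping redexes to instances of overlaps.
-/

namespace Rewriting

open FirstOrder Relation

variable {L : FirstOrder.Language.{u, v}} {V : Type w}

/-! ### Substitutions and variable occurrences -/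

theorem subst_subst (t : L.Term V) (σ τ : V → L.Term V) :
    (t.subst σ).subst τ = t.subst (fun x => (σ x).subst τ) := by
  induction t with
  | var x => rfl
  | func f ts ih => simp only [Language.Term.subst, ih]

theorem subst_var (t : L.Term V) : t.subst Language.Term.var = t := by
  induction t with
  | var x => rfl
  | func f ts ih => simp only [Language.Term.subst, ih]

theorem mem_vars_func {n : ℕ} {f : L.Functions n} {ts : Fin n → L.Term V} {x : V} :
    x ∈ vars (Language.Term.func f ts) ↔ ∃ i, x ∈ vars (ts i) := by
  simp [vars, count, Finset.sum_pos_iff]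

theorem mem_vars_var {x y : V} : x ∈ vars (Language.Term.var y : L.Term V) ↔ x = y := by
  by_cases h : x = y <;> simp [vars, count, h]

theorem subst_congr {t : L.Term V} {σ τ : V → L.Term V} (h : ∀ x ∈ vars t, σ x = τ x) :
    t.subst σ = t.subst τ := by
  induction t with
  | var x => exact h x (mem_vars_var.2 rfl)
  | func f ts ih =>
    simp only [Language.Term.subst]
    congr 1
    funext i
    exact ih i fun x hx => h x (mem_vars_func.2 ⟨i, hx⟩)

theorem eqOn_vars_of_subst_eq {t : L.Term V} {σ τ : V → L.Term V} (h : t.subst σ = t.subst τ) :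
    ∀ x ∈ vars t, σ x = τ x := by
  induction t with
  | var y =>
    intro x hx
    rw [mem_vars_var.1 hx]
    exact h
  | func f ts ih =>
    intro x hx
    obtain ⟨i, hi⟩ := mem_vars_func.1 hx
    simp only [Language.Term.subst, Language.Term.func.injEq, heq_eq_eq, true_and] at h
    exact ih i (congrFun h i) x hi

theorem finite_vars (t : L.Term V) : (vars t).Finite := by
  induction t with
  | var y =>
    refine (Set.finite_singleton y).subset fun x hx => ?_
    exact mem_vars_var.1 hx
  | func f ts ih =>
    refine (Set.finite_iUnion ih).subset fun x hx => ?_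
    simpa using mem_vars_func.1 hx

/-! ### Positions -/

theorem subtermAt_func_cons {n : ℕ} {f : L.Functions n} {ts : Fin n → L.Term V} {i : ℕ}
    {p : List ℕ} {u : L.Term V} :
    subtermAt (.func f ts) (i :: p) = some u ↔
      ∃ j : Fin n, (j : ℕ) = i ∧ subtermAt (ts j) p = some u := by
  by_cases h : i < n
  · simp only [subtermAt, h, dif_pos]
    constructor
    · exact fun hu => ⟨⟨i, h⟩, rfl, hu⟩
    · rintro ⟨j, rfl, hu⟩
      exact hu
  · simp only [subtermAt, h, dif_neg, not_false_eq_true, reduceCtorEq, false_iff]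
    rintro ⟨j, rfl, -⟩
    exact h j.2

theorem replaceAt_func_cons {n : ℕ} (f : L.Functions n) (ts : Fin n → L.Term V) (j : Fin n)
    (p : List ℕ) (v : L.Term V) :
    replaceAt (.func f ts) (j :: p) v =
      .func f (Function.update ts j (replaceAt (ts j) p v)) := by
  simp only [replaceAt]
  congr 1
  funext k
  by_cases h : k = j
  · subst h; simp
  · simp [h, Fin.val_inj]

theorem subtermAt_subst {t u : L.Term V} {p : List ℕ} (h : subtermAt t p = some u)
    (σ : V → L.Term V) : subtermAt (t.subst σ) p = some (u.subst σ) := by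
  induction p generalizing t with
  | nil =>
    simp only [subtermAt, Option.some.injEq] at h ⊢
    rw [h]
  | cons i p ih =>
    cases t with
    | var x => simp [subtermAt] at h
    | func f ts =>
      obtain ⟨j, rfl, hj⟩ := subtermAt_func_cons.1 h
      exact subtermAt_func_cons.2 ⟨j, rfl, ih hj⟩

theorem replaceAt_subst {t u : L.Term V} {p : List ℕ} (h : subtermAt t p = some u)
    (v : L.Term V) (σ : V → L.Term V) :
    (replaceAt t p v).subst σ = replaceAt (t.subst σ) p (v.subst σ) := by
  induction p generalizing t with
  | nil => simp [replaceAt]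
  | cons i p ih =>
    cases t with
    | var x => simp [subtermAt] at h
    | func f ts =>
      obtain ⟨j, rfl, hj⟩ := subtermAt_func_cons.1 h
      simp only [Language.Term.subst, replaceAt_func_cons, ← ih hj]
      congr 1
      funext k
      by_cases hk : k = j
      · subst hk; simp
      · simp [hk]

theorem subtermAt_append {t u : L.Term V} {p q : List ℕ} (h : subtermAt t p = some u) :
    subtermAt t (p ++ q) = subtermAt u q := by
  induction p generalizing t with
  | nil =>
    simp only [subtermAt, Option.some.injEq] at h
    rw [h, List.nil_append]
  | cons i p ih =>
    cases t with
    | var x => simp [subtermAt] at h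
    | func f ts =>
      obtain ⟨j, rfl, hj⟩ := subtermAt_func_cons.1 h
      rw [← ih hj]
      simp [subtermAt]

theorem replaceAt_append {t u : L.Term V} {p q : List ℕ} (h : subtermAt t p = some u)
    (v : L.Term V) : replaceAt t (p ++ q) v = replaceAt t p (replaceAt u q v) := by
  induction p generalizing t with
  | nil =>
    simp only [subtermAt, Option.some.injEq] at h
    rw [h, List.nil_append]
    simp [replaceAt]
  | cons i p ih =>
    cases t with
    | var x => simp [subtermAt] at h
    | func f ts =>
      obtain ⟨j, rfl, hj⟩ := subtermAt_func_cons.1 h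
      rw [List.cons_append, replaceAt_func_cons, replaceAt_func_cons, ih hj]

theorem vars_subset_of_subtermAt {t u : L.Term V} {p : List ℕ} (h : subtermAt t p = some u) :
    vars u ⊆ vars t := by
  induction p generalizing t with
  | nil =>
    simp only [subtermAt, Option.some.injEq] at h
    rw [h]
  | cons i p ih =>
    cases t with
    | var x => simp [subtermAt] at h
    | func f ts =>
      obtain ⟨j, rfl, hj⟩ := subtermAt_func_cons.1 h
      exact fun x hx => mem_vars_func.2 ⟨j, ih hj hx⟩

/-- A position of `tσ` either is the position of a function symbol of `t`, or lies at or below a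
variable of `t`. -/
theorem subtermAt_subst_cases {t u : L.Term V} {σ : V → L.Term V} {p : List ℕ}
    (h : subtermAt (t.subst σ) p = some u) :
    (∃ t', subtermAt t p = some t' ∧ (∀ x, t' ≠ .var x) ∧ u = t'.subst σ) ∨
      ∃ p₁ p₂ x, p = p₁ ++ p₂ ∧ subtermAt t p₁ = some (.var x) ∧
        subtermAt (σ x) p₂ = some u := by
  induction t generalizing p with
  | var x => exact Or.inr ⟨[], p, x, rfl, rfl, h⟩
  | func f ts ih =>
    cases p with
    | nil =>
      simp only [subtermAt, Option.some.injEq] at h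
      exact Or.inl ⟨_, rfl, fun x => by simp, h.symm⟩
    | cons i p =>
      obtain ⟨j, rfl, hj⟩ := subtermAt_func_cons.1 h
      rcases ih j hj with ⟨t', h₁, h₂, h₃⟩ | ⟨p₁, p₂, x, rfl, h₂, h₃⟩
      · exact Or.inl ⟨t', subtermAt_func_cons.2 ⟨j, rfl, h₁⟩, h₂, h₃⟩
      · exact Or.inr ⟨j :: p₁, p₂, x, rfl, subtermAt_func_cons.2 ⟨j, rfl, h₂⟩, h₃⟩

theorem count_func_le_one_cases {n : ℕ} {f : L.Functions n} {ts : Fin n → L.Term V} {x : V}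
    (h : count x (.func f ts) ≤ 1) {j : Fin n} (hj : x ∈ vars (ts j)) :
    count x (ts j) ≤ 1 ∧ ∀ k, k ≠ j → x ∉ vars (ts k) := by
  classical
  simp only [count] at h
  refine ⟨(Finset.single_le_sum (f := fun i => count x (ts i)) (fun _ _ => Nat.zero_le _)
    (Finset.mem_univ j)).trans h, fun k hk hx => ?_⟩
  have h₂ := Finset.add_le_sum (f := fun i => count x (ts i)) (s := Finset.univ)
    (fun _ _ => Nat.zero_le _) (Finset.mem_univ k) (Finset.mem_univ j) hk
  have hj' : 0 < count x (ts j) := hj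
  have hk' : 0 < count x (ts k) := hx
  omega

theorem subst_update_of_notMem [DecidableEq V] {t : L.Term V} {x : V} (h : x ∉ vars t)
    (σ : V → L.Term V) (v : L.Term V) : t.subst (Function.update σ x v) = t.subst σ :=
  subst_congr fun y hy => Function.update_of_ne (by rintro rfl; exact h hy) _ _

/-- For a variable occurring only once, replacing the instance of this occurrence amounts to
changing the substitution. -/
theorem replaceAt_subst_of_count_le_one [DecidableEq V] {t : L.Term V} {x : V} {p : List ℕ}
    (h : subtermAt t p = some (.var x)) (hx : count x t ≤ 1) (σ : V → L.Term V) (v : L.Term V) :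
    replaceAt (t.subst σ) p v = t.subst (Function.update σ x v) := by
  induction p generalizing t with
  | nil =>
    simp only [subtermAt, Option.some.injEq] at h
    subst h
    simp [replaceAt, Language.Term.subst]
  | cons i p ih =>
    cases t with
    | var x => simp [subtermAt] at h
    | func f ts =>
      obtain ⟨j, rfl, hj⟩ := subtermAt_func_cons.1 h
      obtain ⟨h₁, h₂⟩ := count_func_le_one_cases hx
        (vars_subset_of_subtermAt hj (mem_vars_var.2 rfl))
      simp only [Language.Term.subst, replaceAt_func_cons, ih hj h₁]
      congr 1
      funext k
      by_cases hk : k = j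
      · subst hk; simp
      · simp only [Function.update_of_ne hk]
        exact (subst_update_of_notMem (h₂ k hk) σ v).symm

/-! ### Closure properties of rewriting -/

theorem Steps.refl {R : Set (Rule L V)} (s : L.Term V) : Steps R s s :=
  ReflTransGen.refl

theorem Steps.single {R : Set (Rule L V)} {s t : L.Term V} (h : Step R s t) : Steps R s t :=
  ReflTransGen.single h

theorem Step.root {R : Set (Rule L V)} {ρ : Rule L V} (h : ρ ∈ R) (σ : V → L.Term V) :
    Step R (ρ.lhs.subst σ) (ρ.rhs.subst σ) :=
  ⟨ρ, h, [], σ, by simp [subtermAt], by simp [replaceAt]⟩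

theorem Step.replaceAt {R : Set (Rule L V)} {s u v : L.Term V} {p : List ℕ}
    (hp : subtermAt s p = some u) (h : Step R u v) : Step R s (replaceAt s p v) := by
  obtain ⟨ρ, hρ, q, σ, h₁, rfl⟩ := h
  exact ⟨ρ, hρ, p ++ q, σ, by rw [subtermAt_append hp, h₁], by rw [replaceAt_append hp]⟩

theorem Step.update {R : Set (Rule L V)} {n : ℕ} {f : L.Functions n} {ts : Fin n → L.Term V}
    {j : Fin n} {v : L.Term V} (h : Step R (ts j) v) :
    Step R (.func f ts) (.func f (Function.update ts j v)) := by
  have := Step.replaceAt (s := .func f ts) (p := [(j : ℕ)])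
    (subtermAt_func_cons.2 ⟨j, rfl, by simp [subtermAt]⟩) h
  rw [replaceAt_func_cons] at this
  simpa only [Rewriting.replaceAt] using this

theorem Steps.update {R : Set (Rule L V)} {n : ℕ} {f : L.Functions n} {ts : Fin n → L.Term V}
    {j : Fin n} {u v : L.Term V} (h : Steps R u v) :
    Steps R (.func f (Function.update ts j u)) (.func f (Function.update ts j v)) := by
  refine ReflTransGen.lift (fun u => Language.Term.func f (Function.update ts j u))
    (fun a b hab => ?_) _ _ h
  have := Step.update (f := f) (ts := Function.update ts j a) (j := j) (v := b)
    (by simpa using hab)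
  simpa using this

theorem Step.subst {R : Set (Rule L V)} {s t : L.Term V} (h : Step R s t) (τ : V → L.Term V) :
    Step R (s.subst τ) (t.subst τ) := by
  obtain ⟨ρ, hρ, p, σ, h₁, rfl⟩ := h
  refine ⟨ρ, hρ, p, fun x => (σ x).subst τ, ?_, ?_⟩
  · rw [subtermAt_subst h₁, subst_subst]
  · rw [replaceAt_subst h₁, subst_subst]

theorem Steps.subst {R : Set (Rule L V)} {s t : L.Term V} (h : Steps R s t) (τ : V → L.Term V) :
    Steps R (s.subst τ) (t.subst τ) := by
  induction h with
  | refl => exact Steps.refl _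
  | tail _ h ih => exact ReflTransGen.tail ih (h.subst τ)

theorem Joinable.subst {R : Set (Rule L V)} {s t : L.Term V} (h : Joinable R s t)
    (τ : V → L.Term V) : Joinable R (s.subst τ) (t.subst τ) := by
  obtain ⟨u, h₁, h₂⟩ := h
  exact ⟨_, h₁.subst τ, h₂.subst τ⟩

theorem Joinable.symm {R : Set (Rule L V)} {s t : L.Term V} (h : Joinable R s t) :
    Joinable R t s := by
  obtain ⟨u, h₁, h₂⟩ := h
  exact ⟨u, h₂, h₁⟩

theorem Steps.func {R : Set (Rule L V)} {n : ℕ} (f : L.Functions n) {ts us : Fin n → L.Term V}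
    (h : ∀ i, Steps R (ts i) (us i)) : Steps R (.func f ts) (.func f us) := by
  classical
  suffices H : ∀ S : Finset (Fin n), Steps R (.func f ts) (.func f (S.piecewise us ts)) by
    simpa using H Finset.univ
  intro S
  induction S using Finset.induction_on with
  | empty => simpa using Steps.refl _
  | insert j S hj ih =>
    have hup := Steps.update (f := f) (ts := S.piecewise us ts) (j := j) (h j)
    rw [← Finset.piecewise_eq_of_notMem S us ts hj, Function.update_eq_self] at hup
    rw [Finset.piecewise_insert]
    exact ih.trans hup

theorem steps_subst_update [DecidableEq V] {R : Set (Rule L V)} (t : L.Term V)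
    {σ : V → L.Term V} {x : V} {v : L.Term V} (h : Step R (σ x) v) :
    Steps R (t.subst σ) (t.subst (Function.update σ x v)) := by
  induction t with
  | var y =>
    by_cases hy : y = x
    · subst hy
      simpa [Language.Term.subst] using Steps.single h
    · simpa [Language.Term.subst, hy] using Steps.refl _
  | func f ts ih => exact Steps.func f ih

theorem reflGen_step_subst_update [DecidableEq V] {R : Set (Rule L V)} {t : L.Term V}
    {σ : V → L.Term V} {x : V} {v : L.Term V} (h : Step R (σ x) v) (ht : count x t ≤ 1) :
    ReflGen (Step R) (t.subst σ) (t.subst (Function.update σ x v)) := by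
  induction t with
  | var y =>
    by_cases hy : y = x
    · subst hy
      simpa [Language.Term.subst] using ReflGen.single h
    · simpa [Language.Term.subst, hy] using ReflGen.refl
  | func f ts ih =>
    by_cases hx : x ∈ vars (.func f ts)
    · obtain ⟨j, hj⟩ := mem_vars_func.1 hx
      obtain ⟨h₁, h₂⟩ := count_func_le_one_cases ht hj
      have key : (fun i => (ts i).subst (Function.update σ x v)) =
          Function.update (fun i => (ts i).subst σ) j
            ((ts j).subst (Function.update σ x v)) := by
        funext k
        by_cases hk : k = j
        · subst hk; simp
        · rw [Function.update_of_ne hk]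
          exact subst_update_of_notMem (h₂ k hk) σ v
      simp only [Language.Term.subst, key]
      rcases reflGen_iff _ _ _ |>.1 (ih j h₁) with h' | h'
      · rw [h']
        simpa using ReflGen.refl
      · exact ReflGen.single (Step.update h')
    · rw [subst_update_of_notMem hx]

/-! ### Unification and renaming apart -/

/-- The number of symbols of a term. -/
def size : L.Term V → ℕ
  | .var _ => 1
  | .func _ ts => 1 + ∑ i, size (ts i)

theorem size_pos (t : L.Term V) : 0 < size t := by
  cases t <;> simp [size]

theorem size_le_size_subst {t : L.Term V} {x : V} (hx : x ∈ vars t) (τ : V → L.Term V) :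
    size (τ x) ≤ size (t.subst τ) := by
  induction t with
  | var y =>
    rw [mem_vars_var.1 hx]
    exact le_rfl
  | func f ts ih =>
    obtain ⟨i, hi⟩ := mem_vars_func.1 hx
    refine (ih i hi).trans ?_
    simp only [Language.Term.subst, size]
    exact (Finset.single_le_sum (f := fun i => size ((ts i).subst τ))
      (fun _ _ => Nat.zero_le _) (Finset.mem_univ i)).trans (Nat.le_add_left _ _)

/-- The occurs check: if `x` and `t` are unifiable then `t` is `x` itself, or `x` does not occur
in `t`. -/
theorem notMem_vars_of_subst_eq {t : L.Term V} {x : V} {τ : V → L.Term V}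
    (h : τ x = t.subst τ) (ht : t ≠ .var x) : x ∉ vars t := by
  intro hx
  cases t with
  | var y => exact ht (by rw [mem_vars_var.1 hx])
  | func f ts =>
    obtain ⟨i, hi⟩ := mem_vars_func.1 hx
    have h₁ := size_le_size_subst hi τ
    have h₂ := Finset.single_le_sum (f := fun i => size ((ts i).subst τ))
      (fun _ _ => Nat.zero_le _) (Finset.mem_univ i)
    have h₃ := congrArg size h
    simp only [Language.Term.subst, size] at h₃
    omega

/-- `τ` solves all equations of the list `E`. -/
def Unifies (τ : V → L.Term V) (E : List (L.Term V × L.Term V)) : Prop :=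
  ∀ e ∈ E, e.1.subst τ = e.2.subst τ

/-- The list `E` of equations has a most general solution. -/
def HasMGU (E : List (L.Term V × L.Term V)) : Prop :=
  ∃ μ : V → L.Term V, Unifies μ E ∧
    ∀ τ, Unifies τ E → ∃ δ : V → L.Term V, ∀ x, τ x = (μ x).subst δ

theorem HasMGU.of_unifies_iff {E E' : List (L.Term V × L.Term V)}
    (h : ∀ τ, Unifies τ E ↔ Unifies τ E') (hE : HasMGU E') : HasMGU E := by
  obtain ⟨μ, h₁, h₂⟩ := hE
  exact ⟨μ, (h μ).2 h₁, fun τ hτ => h₂ τ ((h τ).1 hτ)⟩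

theorem unifies_cons {τ : V → L.Term V} {s t : L.Term V} {E : List (L.Term V × L.Term V)} :
    Unifies τ ((s, t) :: E) ↔ s.subst τ = t.subst τ ∧ Unifies τ E := by
  simp [Unifies]

/-- Elimination of the variable `x` by means of the equation `x = t`. -/
theorem HasMGU.cons_var [DecidableEq V] {x : V} {t : L.Term V} {E : List (L.Term V × L.Term V)}
    (hx : x ∉ vars t)
    (hE : HasMGU (E.map fun e => (e.1.subst (Function.update Language.Term.var x t),
      e.2.subst (Function.update Language.Term.var x t)))) :
    HasMGU ((.var x, t) :: E) := by
  obtain ⟨μ, h₁, h₂⟩ := hE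
  set β : V → L.Term V := Function.update Language.Term.var x t with hβ
  have hcomp : ∀ τ : V → L.Term V, τ x = t.subst τ → ∀ y, (β y).subst τ = τ y := by
    intro τ hτ y
    by_cases hy : y = x
    · subst hy
      simp [hβ, hτ]
    · simp [hβ, hy, Language.Term.subst]
  have ht : t.subst β = t := by rw [hβ, subst_update_of_notMem hx, subst_var]
  refine ⟨fun y => (β y).subst μ, unifies_cons.2 ⟨?_, fun e he => ?_⟩, fun τ hτ => ?_⟩
  · rw [← subst_subst, ← subst_subst, ht]
    simp [Language.Term.subst, hβ]
  · rw [← subst_subst, ← subst_subst]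
    exact h₁ _ (List.mem_map.2 ⟨e, he, rfl⟩)
  · obtain ⟨hτ₁, hτ₂⟩ := unifies_cons.1 hτ
    have hτβ := hcomp τ hτ₁
    obtain ⟨δ, hδ⟩ := h₂ τ (by
      intro e he
      obtain ⟨e', he', rfl⟩ := List.mem_map.1 he
      simp only [subst_subst, hτβ]
      exact hτ₂ e' he')
    refine ⟨δ, fun y => ?_⟩
    rw [← hτβ y, subst_subst]
    congr 1
    funext z
    exact hδ z

/-- A solvable list of equations has a most general solution. The usual unification procedure
is shown to terminate by means of the total size of the left-hand sides under the fixed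
solution `τ`: this size decreases both when an equation between compound terms is decomposed and
when a variable is eliminated. -/
theorem hasMGU_of_unifies (E : List (L.Term V × L.Term V)) (τ : V → L.Term V)
    (hτ : Unifies τ E) : HasMGU E := by
  classical
  induction hm : (E.map fun e => size (e.1.subst τ)).sum using Nat.strong_induction_on
    generalizing E with
  | _ m ih =>
    have elim : ∀ (x : V) (t : L.Term V) (E : List (L.Term V × L.Term V)),
        Unifies τ ((.var x, t) :: E) →
        (((.var x, t) :: E).map fun e => size (e.1.subst τ)).sum = m →
        HasMGU ((.var x, t) :: E) := by
      intro x t E hτ hm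
      obtain ⟨hτ₁, hτ₂⟩ := unifies_cons.1 hτ
      simp only [List.map_cons, List.sum_cons] at hm
      have hpos := size_pos ((Language.Term.var x : L.Term V).subst τ)
      by_cases ht : t = .var x
      · refine HasMGU.of_unifies_iff (fun τ => ?_) (ih _ (by omega) E hτ₂ rfl)
        simp [unifies_cons, ht]
      · refine HasMGU.cons_var (notMem_vars_of_subst_eq hτ₁ ht) ?_
        have hβ : (fun y => ((Function.update Language.Term.var x t : V → L.Term V) y).subst τ) =
            τ := by
          funext y
          by_cases hy : y = x
          · subst hy
            simpa using hτ₁.symm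
          · simp [hy, Language.Term.subst]
        refine ih _ ?_ _ ?_ rfl
        · simp only [List.map_map, Function.comp_def, subst_subst, hβ]
          omega
        · intro e he
          obtain ⟨e', he', rfl⟩ := List.mem_map.1 he
          simp only [subst_subst, hβ]
          exact hτ₂ e' he'
    match E, hτ, hm with
    | [], _, _ => exact ⟨Language.Term.var, by simp [Unifies], fun τ _ => ⟨τ, fun _ => rfl⟩⟩
    | (.var x, t) :: E, hτ, hm => exact elim x t E hτ hm
    | (.func f ts, .var x) :: E, hτ, hm =>
      obtain ⟨hτ₁, hτ₂⟩ := unifies_cons.1 hτ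
      refine HasMGU.of_unifies_iff (fun τ => ?_)
        (elim x (.func f ts) E (unifies_cons.2 ⟨hτ₁.symm, hτ₂⟩) ?_)
      · rw [unifies_cons, unifies_cons, eq_comm]
      · simp only [List.map_cons, List.sum_cons] at hm ⊢
        rwa [← hτ₁]
    | (.func (l := k) f ts, .func (l := n) g us) :: E, hτ, hm =>
      obtain ⟨hτ₁, hτ₂⟩ := unifies_cons.1 hτ
      obtain rfl : k = n := by
        simp only [Language.Term.subst, Language.Term.func.injEq] at hτ₁
        exact hτ₁.1
      obtain rfl : f = g := by
        simp only [Language.Term.subst, Language.Term.func.injEq, heq_eq_eq] at hτ₁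
        exact hτ₁.2.1
      have key : ∀ τ : V → L.Term V, Unifies τ ((.func f ts, .func f us) :: E) ↔
          Unifies τ (List.ofFn (fun i => (ts i, us i)) ++ E) := by
        intro τ
        simp only [unifies_cons, Language.Term.subst, Language.Term.func.injEq, heq_eq_eq,
          true_and]
        constructor
        · rintro ⟨h₁, h₂⟩ e he
          rcases List.mem_append.1 he with he | he
          · obtain ⟨i, rfl⟩ := (List.mem_ofFn' _ _).1 he
            exact congrFun h₁ i
          · exact h₂ e he
        · intro h
          refine ⟨funext fun i => ?_, fun e he => h e (List.mem_append_right _ he)⟩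
          exact h (ts i, us i) (List.mem_append_left _ ((List.mem_ofFn' _ _).2 ⟨i, rfl⟩))
      refine HasMGU.of_unifies_iff key (ih _ ?_ _ ((key τ).1 hτ) rfl)
      simp only [List.map_cons, List.sum_cons, Language.Term.subst, size] at hm
      simp only [List.map_append, List.sum_append, List.map_ofFn, List.sum_ofFn,
        Function.comp_def]
      omega

theorem exists_isMGU {s t : L.Term V} {τ : V → L.Term V} (h : s.subst τ = t.subst τ) :
    ∃ μ, IsMGU μ s t := by
  obtain ⟨μ, h₁, h₂⟩ := hasMGU_of_unifies [(s, t)] τ (by simpa [Unifies] using h)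
  exact ⟨μ, by simpa [Unifies] using h₁, fun τ hτ => h₂ τ (by simpa [Unifies] using hτ)⟩

theorem exists_perm_image_disjoint [Infinite V] {A B : Set V} (hA : A.Finite) (hB : B.Finite) :
    ∃ π : Equiv.Perm V, Disjoint (π '' A) B := by
  classical
  obtain ⟨C, hC, hcard⟩ := hB.infinite_compl.exists_subset_card_eq hA.toFinset.card
  have hpre := Equiv.Perm.isMultiplyPretransitive V hA.toFinset.card
  obtain ⟨π, hπ⟩ := MulAction.isMultiplyPretransitive_iff.1 hpre
    (hA.toFinset.equivFin.symm.toEmbedding.trans (Function.Embedding.subtype _))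
    ((C.equivFinOfCardEq hcard).symm.toEmbedding.trans (Function.Embedding.subtype _))
  refine ⟨π, Set.disjoint_left.2 ?_⟩
  rintro _ ⟨a, ha, rfl⟩
  have h := DFunLike.congr_fun hπ (hA.toFinset.equivFin ⟨a, hA.mem_toFinset.2 ha⟩)
  have ha' : π a = ((C.equivFinOfCardEq hcard).symm
      (hA.toFinset.equivFin ⟨a, hA.mem_toFinset.2 ha⟩) : V) := by
    simpa using h
  rw [ha']
  exact hC (Subtype.property _)

theorem mem_vars_rename {t : L.Term V} {f : V → V} {y : V} :
    y ∈ vars (t.subst fun x => .var (f x)) ↔ ∃ x ∈ vars t, f x = y := by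
  induction t with
  | var x => simp [Language.Term.subst, mem_vars_var, eq_comm]
  | func g ts ih =>
    simp only [Language.Term.subst, mem_vars_func, ih]
    exact ⟨fun ⟨i, x, h₁, h₂⟩ => ⟨x, ⟨i, h₁⟩, h₂⟩, fun ⟨x, ⟨i, h₁⟩, h₂⟩ => ⟨i, x, h₁, h₂⟩⟩

theorem Rule.IsVariant.refl (ρ : Rule L V) : ρ.IsVariant ρ :=
  ⟨Equiv.refl V, (subst_var _).symm, (subst_var _).symm⟩

theorem Rule.finite_vars (ρ : Rule L V) : ρ.vars.Finite :=
  (Rewriting.finite_vars _).union (Rewriting.finite_vars _)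

/-- Any overlap situation is an instance of an overlap: if an instance of `ρ₁.lhs` coincides
with an instance of the non-variable subterm of `ρ₂.lhs` at position `p`, then for a renaming `ρ`
of `ρ₁` without variables of `ρ₂` either `p` is the root position and `ρ` is a variant of `ρ₂`, or
the situation is an instance of an overlap between `ρ` and `ρ₂`. -/
theorem exists_overlap [Infinite V] {R : Set (Rule L V)} {ρ₁ ρ₂ : Rule L V} (h₁ : ρ₁ ∈ R)
    (h₂ : ρ₂ ∈ R) {p : List ℕ} {t : L.Term V} (hp : subtermAt ρ₂.lhs p = some t)
    (ht : ∀ x, t ≠ .var x) {σ₁ σ₂ : V → L.Term V} (h : ρ₁.lhs.subst σ₁ = t.subst σ₂) :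
    ∃ ρ τ, ρ.lhs.subst τ = ρ₁.lhs.subst σ₁ ∧ ρ.rhs.subst τ = ρ₁.rhs.subst σ₁ ∧
      ρ₂.lhs.subst τ = ρ₂.lhs.subst σ₂ ∧ ρ₂.rhs.subst τ = ρ₂.rhs.subst σ₂ ∧
      ((p = [] ∧ ρ.IsVariant ρ₂) ∨
        ∃ μ δ, IsOverlap R ρ p ρ₂ μ ∧ ∀ x, τ x = (μ x).subst δ) := by
  classical
  obtain ⟨π, hπ⟩ := exists_perm_image_disjoint ρ₁.finite_vars ρ₂.finite_vars
  set ρ : Rule L V := ⟨ρ₁.lhs.subst fun x => .var (π x), ρ₁.rhs.subst fun x => .var (π x)⟩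
    with hρ
  set τ : V → L.Term V := fun x => if x ∈ ρ₂.vars then σ₂ x else σ₁ (π.symm x) with hτ
  have hτ₁ : ∀ x ∈ ρ₁.vars, τ (π x) = σ₁ x := fun x hx => by
    have : π x ∉ ρ₂.vars := Set.disjoint_left.1 hπ ⟨x, hx, rfl⟩
    simp [hτ, this]
  have hτ₂ : ∀ x ∈ ρ₂.vars, τ x = σ₂ x := fun x hx => by simp [hτ, hx]
  have hl : ρ.lhs.subst τ = ρ₁.lhs.subst σ₁ := by
    simp only [hρ, subst_subst]
    exact subst_congr fun x hx => hτ₁ x (Or.inl hx)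
  have hr : ρ.rhs.subst τ = ρ₁.rhs.subst σ₁ := by
    simp only [hρ, subst_subst]
    exact subst_congr fun x hx => hτ₁ x (Or.inr hx)
  refine ⟨ρ, τ, hl, hr, subst_congr fun x hx => hτ₂ x (Or.inl hx),
    subst_congr fun x hx => hτ₂ x (Or.inr hx), ?_⟩
  by_cases hv : p = [] ∧ ρ.IsVariant ρ₂
  · exact Or.inl hv
  · right
    have hunif : ρ.lhs.subst τ = t.subst τ := by
      rw [hl, h]
      exact subst_congr fun x hx => (hτ₂ x (Or.inl (vars_subset_of_subtermAt hp hx))).symm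
    obtain ⟨μ, hμ⟩ := exists_isMGU hunif
    obtain ⟨δ, hδ⟩ := hμ.2 τ hunif
    refine ⟨μ, δ, ⟨⟨ρ₁, h₁, π, rfl, rfl⟩, ⟨ρ₂, h₂, Rule.IsVariant.refl _⟩, ?_,
      ⟨t, hp, ht, hμ⟩, fun hp hv' => hv ⟨hp, hv'⟩⟩, hδ⟩
    refine Set.disjoint_left.2 fun y hy => Set.disjoint_left.1 hπ ?_
    rcases hy with hy | hy
    · obtain ⟨x, hx, rfl⟩ := mem_vars_rename.1 hy
      exact ⟨x, Or.inl hx, rfl⟩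
    · obtain ⟨x, hx, rfl⟩ := mem_vars_rename.1 hy
      exact ⟨x, Or.inr hx, rfl⟩

/-! ### Local peaks -/

theorem RelStep.of_step {R S : Set (Rule L V)} {s t : L.Term V} (h : Step R s t) :
    RelStep R S s t :=
  ⟨s, t, Steps.refl s, h, Steps.refl t⟩

theorem RelStep.head {R S : Set (Rule L V)} {s s' t : L.Term V} (h : Steps S s s')
    (h' : RelStep R S s' t) : RelStep R S s t := by
  obtain ⟨a, b, h₁, h₂, h₃⟩ := h'
  exact ⟨a, b, h.trans h₁, h₂, h₃⟩

theorem RelStep.update {R S : Set (Rule L V)} {n : ℕ} {f : L.Functions n}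
    {ts : Fin n → L.Term V} {j : Fin n} {v : L.Term V} (h : RelStep R S (ts j) v) :
    RelStep R S (.func f ts) (.func f (Function.update ts j v)) := by
  obtain ⟨a, b, h₁, h₂, h₃⟩ := h
  refine ⟨.func f (Function.update ts j a), .func f (Function.update ts j b), ?_, ?_,
    Steps.update h₃⟩
  · simpa using Steps.update (f := f) (ts := ts) (j := j) h₁
  · simpa using Step.update (f := f) (ts := Function.update ts j a) (j := j) (v := b)
      (by simpa using h₂)

/-- The property of a local peak `t ← x → y` on which the confluence proof rests: it is joinable,
and if `y` is not smaller than `x` in the well-founded relation `RelStep`, then it can be joined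
with at most one step from `y`. -/
def PeakJoin (R : Set (Rule L V)) (x t y : L.Term V) : Prop :=
  Joinable R t y ∧ (RelStep (CPS R ∪ dupl R) (nonDupl R) x y ∨
    ∃ u, Steps R t u ∧ ReflGen (Step R) y u)

theorem PeakJoin.of_reflGen {R : Set (Rule L V)} {x t y u : L.Term V} (h₁ : Steps R t u)
    (h₂ : ReflGen (Step R) y u) : PeakJoin R x t y :=
  ⟨⟨u, h₁, h₂.to_reflTransGen⟩, Or.inr ⟨u, h₁, h₂⟩⟩

theorem PeakJoin.update {R : Set (Rule L V)} {n : ℕ} {f : L.Functions n}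
    {ts : Fin n → L.Term V} {j : Fin n} {t y : L.Term V} (h : PeakJoin R (ts j) t y) :
    PeakJoin R (.func f ts) (.func f (Function.update ts j t))
      (.func f (Function.update ts j y)) := by
  obtain ⟨⟨u, h₁, h₂⟩, h₃⟩ := h
  refine ⟨⟨_, Steps.update h₁, Steps.update h₂⟩, ?_⟩
  rcases h₃ with h₃ | ⟨u, h₃, h₄⟩
  · exact Or.inl h₃.update
  · refine Or.inr ⟨_, Steps.update h₃, ?_⟩
    rcases (reflGen_iff _ _ _).1 h₄ with rfl | h₄
    · exact ReflGen.refl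
    · refine ReflGen.single ?_
      simpa using Step.update (f := f) (ts := Function.update ts j y) (j := j) (v := u)
        (by simpa using h₄)

/-- Renaming does not change the result of contracting a given redex, because the variables of
the right-hand side of a rule occur in its left-hand side. -/
theorem Rule.IsVariant.rhs_subst_eq {ρ ρ' : Rule L V} (h : ρ'.IsVariant ρ)
    (hρ : Rewriting.vars ρ.rhs ⊆ Rewriting.vars ρ.lhs) {σ τ : V → L.Term V}
    (heq : ρ'.lhs.subst τ = ρ.lhs.subst σ) : ρ'.rhs.subst τ = ρ.rhs.subst σ := by
  obtain ⟨π, h₁, h₂⟩ := h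
  rw [h₁, subst_subst] at heq
  rw [h₂, subst_subst]
  exact subst_congr fun x hx => eqOn_vars_of_subst_eq heq x (hρ hx)

/-- Local peaks one of whose steps is a root step. -/
theorem peakJoin_root [Infinite V] {R : Set (Rule L V)} (hR : IsTRS R) (hlin : LeftLinear R)
    (hcp : ∀ s t : L.Term V, CriticalPair R s t → Joinable R s t) {ρ : Rule L V} (hρ : ρ ∈ R)
    {σ : V → L.Term V} {t : L.Term V} (h : Step R (ρ.lhs.subst σ) t) :
    PeakJoin R (ρ.lhs.subst σ) t (ρ.rhs.subst σ) ∧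
      PeakJoin R (ρ.lhs.subst σ) (ρ.rhs.subst σ) t := by
  classical
  obtain ⟨ρ₁, hρ₁, p, σ₁, hp, rfl⟩ := h
  rcases subtermAt_subst_cases hp with ⟨t', ht', hvar, heq⟩ | ⟨p₁, p₂, x, rfl, hx, hp₂⟩
  · obtain ⟨ρ', τ, hl', hr', hl, hr, ⟨rfl, hv⟩ | ⟨μ, δ, hov, hδ⟩⟩ :=
      exists_overlap hρ₁ hρ ht' hvar heq
    · simp only [subtermAt, Option.some.injEq] at hp
      have hroot : ρ₁.rhs.subst σ₁ = ρ.rhs.subst σ := by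
        rw [← hr']
        exact hv.rhs_subst_eq (hR.vars_rhs ρ hρ) (hl'.trans hp.symm)
      simp only [replaceAt, hroot]
      exact ⟨.of_reflGen (Steps.refl _) .refl, .of_reflGen (Steps.refl _) .refl⟩
    · obtain rfl : τ = fun x => (μ x).subst δ := funext hδ
      have hleft : (replaceAt (ρ.lhs.subst μ) p (ρ'.rhs.subst μ)).subst δ =
          replaceAt (ρ.lhs.subst σ) p (ρ₁.rhs.subst σ₁) := by
        rw [replaceAt_subst (subtermAt_subst ht' μ), subst_subst, subst_subst, hl, hr']
      have hright : (ρ.rhs.subst μ).subst δ = ρ.rhs.subst σ := by rw [subst_subst, hr]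
      have hpeak : (ρ.lhs.subst μ).subst δ = ρ.lhs.subst σ := by rw [subst_subst, hl]
      have hj := (hcp _ _ ⟨ρ', p, ρ, μ, hov, rfl, rfl⟩).subst δ
      have hs₁ := Step.root (R := CPS R ∪ dupl R)
        (Or.inl ⟨ρ', p, ρ, μ, hov, Or.inl rfl⟩) δ
      have hs₂ := Step.root (R := CPS R ∪ dupl R)
        (Or.inl ⟨ρ', p, ρ, μ, hov, Or.inr rfl⟩) δ
      simp only [hleft, hright, hpeak] at hj hs₁ hs₂
      exact ⟨⟨hj, Or.inl (RelStep.of_step hs₂)⟩, ⟨hj.symm, Or.inl (RelStep.of_step hs₁)⟩⟩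
  · rw [replaceAt_append (subtermAt_subst hx σ),
      replaceAt_subst_of_count_le_one hx (hlin ρ hρ x)]
    have hstep : Step R (σ x) (replaceAt (σ x) p₂ (ρ₁.rhs.subst σ₁)) :=
      (Step.root hρ₁ σ₁).replaceAt hp₂
    have hroot := Step.root hρ (Function.update σ x (replaceAt (σ x) p₂ (ρ₁.rhs.subst σ₁)))
    have hsteps := steps_subst_update ρ.rhs hstep
    refine ⟨⟨⟨_, Steps.single hroot, hsteps⟩, ?_⟩, .of_reflGen hsteps (.single hroot)⟩
    by_cases hd : ρ.Duplicating
    · exact Or.inl (RelStep.of_step (Step.root (Or.inr ⟨hρ, hd⟩) σ))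
    · refine Or.inr ⟨_, Steps.single hroot, reflGen_step_subst_update hstep ?_⟩
      exact (not_lt.1 fun hlt => hd ⟨x, hlt⟩).trans (hlin ρ hρ x)

theorem peakJoin_of_step [Infinite V] {R : Set (Rule L V)} (hR : IsTRS R) (hlin : LeftLinear R)
    (hcp : ∀ s t : L.Term V, CriticalPair R s t → Joinable R s t) {s t y : L.Term V}
    (ht : Step R s t) (hy : Step R s y) : PeakJoin R s t y := by
  have ht' := ht
  have hy' := hy
  obtain ⟨ρ₁, hρ₁, p, σ₁, hp, rfl⟩ := ht
  obtain ⟨ρ₂, hρ₂, q, σ₂, hq, rfl⟩ := hy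
  induction p generalizing s q with
  | nil =>
    simp only [subtermAt, Option.some.injEq] at hp
    subst hp
    simpa only [replaceAt] using (peakJoin_root hR hlin hcp hρ₁ hy').2
  | cons i p ih =>
    cases q with
    | nil =>
      simp only [subtermAt, Option.some.injEq] at hq
      subst hq
      simpa only [replaceAt] using (peakJoin_root hR hlin hcp hρ₂ ht').1
    | cons j q =>
      cases s with
      | var x => simp [subtermAt] at hp
      | func f ts =>
        obtain ⟨i, rfl, hi⟩ := subtermAt_func_cons.1 hp
        obtain ⟨j, rfl, hj⟩ := subtermAt_func_cons.1 hq
        have hsi := (Step.root hρ₁ σ₁).replaceAt hi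
        have hsj := (Step.root hρ₂ σ₂).replaceAt hj
        rw [replaceAt_func_cons, replaceAt_func_cons]
        by_cases hij : i = j
        · subst hij
          exact (ih hi hsi q hj hsj).update
        · -- the two steps take place in different arguments
          refine .of_reflGen (Steps.single (Step.update (j := j) (v := replaceAt (ts j) q
            (ρ₂.rhs.subst σ₂)) ?_)) (.single ?_)
          · rwa [Function.update_of_ne (Ne.symm hij)]
          · rw [Function.update_comm hij]
            refine Step.update ?_
            rwa [Function.update_of_ne hij]

/-! ### Confluence -/

/-- Confluence from joinability of local peaks in the sense of `PeakJoin`, by well-founded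
induction along `RelStep`. -/
theorem confluent_of_peakJoin {R : Set (Rule L V)}
    (hterm : RelTerminating (CPS R ∪ dupl R) (nonDupl R))
    (hpeak : ∀ s t y : L.Term V, Step R s t → Step R s y → PeakJoin R s t y) :
    Confluent R := by
  intro s
  induction s using hterm.induction with
  | _ s ih =>
    have hstep : ∀ {x y : L.Term V}, Steps (nonDupl R) s x → Step R x y →
        RelStep (CPS R ∪ dupl R) (nonDupl R) s y ∨ Steps (nonDupl R) s y := by
      rintro x y hx ⟨ρ, hρ, h⟩
      by_cases hd : ρ.Duplicating
      · exact Or.inl (.head hx (.of_step ⟨ρ, Or.inr ⟨hρ, hd⟩, h⟩))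
      · exact Or.inr (ReflTransGen.tail hx ⟨ρ, ⟨hρ, hd⟩, h⟩)
    -- Below `s` along non-duplicating steps the induction hypothesis for `s` remains available.
    have semi : ∀ {x t' : L.Term V}, Steps R x t' → Steps (nonDupl R) s x →
        ∀ {t : L.Term V}, Step R x t → Joinable R t t' := by
      intro x t' hxt'
      induction hxt' using ReflTransGen.head_induction_on with
      | refl => exact fun _ t ht => ⟨t, Steps.refl t, Steps.single ht⟩
      | @head x y hxy hyt' ihy =>
        intro hx t ht
        obtain ⟨⟨u, htu, hyu⟩, hcase⟩ := hpeak x t y ht hxy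
        have hsmall : RelStep (CPS R ∪ dupl R) (nonDupl R) s y → Joinable R t t' := by
          intro hlt
          obtain ⟨v, huv, htv⟩ := ih y hlt u t' hyu hyt'
          exact ⟨v, htu.trans huv, htv⟩
        rcases hcase with hlt | ⟨u, htu, hyu⟩
        · exact hsmall (.head hx hlt)
        · rcases hstep hx hxy with hlt | hy
          · exact hsmall hlt
          · rcases (reflGen_iff _ _ _).1 hyu with rfl | hyu
            · exact ⟨t', htu.trans hyt', Steps.refl t'⟩
            · obtain ⟨v, huv, htv⟩ := ihy hy hyu
              exact ⟨v, htu.trans huv, htv⟩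
    have conf : ∀ {x t₁ : L.Term V}, Steps R x t₁ → Steps (nonDupl R) s x →
        ∀ {t₂ : L.Term V}, Steps R x t₂ → Joinable R t₁ t₂ := by
      intro x t₁ hxt
      induction hxt using ReflTransGen.head_induction_on with
      | refl => exact fun _ t₂ h₂ => ⟨t₂, h₂, Steps.refl t₂⟩
      | @head x y hxy hyt ihy =>
        intro hx t₂ h₂
        obtain ⟨v, hyv, htv⟩ := semi h₂ hx hxy
        obtain ⟨z, h₁, h₃⟩ : Joinable R t₁ v := by
          rcases hstep hx hxy with hlt | hy
          · exact ih y hlt t₁ v hyt hyv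
          · exact ihy hy hyv
        exact ⟨z, h₁, htv.trans h₃⟩
    exact fun t₁ t₂ h₁ h₂ => conf h₁ (Steps.refl s) h₂

end Rewriting

theorem mainTheorem2 {L : FirstOrder.Language.{u, v}} {V : Type w} [Infinite V]
    (R : Set (Rewriting.Rule L V)) (hR : Rewriting.IsTRS R) (hlin : Rewriting.LeftLinear R)
    (hcp : ∀ s t : L.Term V, Rewriting.CriticalPair R s t → Rewriting.Joinable R s t)
    (hterm : Rewriting.RelTerminating (Rewriting.CPS R ∪ Rewriting.dupl R)
      (Rewriting.nonDupl R)) :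
    Rewriting.Confluent R :=
  Rewriting.confluent_of_peakJoin hterm fun _ _ _ => Rewriting.peakJoin_of_step hR hlin hcp
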